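/- For $\mu>0$ let $\eta:\mathbf R\to\mathbf R$ be a function such that (i) $\eta\ge 0$, $\eta$ is even and convex; (ii) $\eta^{-1}(0)=[-\mu,\mu]$; (iii) there is $a>0$ with $\eta(x)>1$ whenever $|x|>a$; (iv) $\eta'(x)$ exists and is nonzero whenever $\eta(x)=1$. The worm with parameter $\mu$ is $$\mathcal W_\mu=\bigl\{(z_1,z_2)\in\mathbf C^2:\ z_2\ne0,\ \bigl|z_1-e^{i\log|z_2|^2}\bigr|^2<1-\eta(\log|z_2|^2)\bigr\}.$$ A defining function for a domain $\Omega\subset\mathbf C^2$ is a real function $\tilde\varrho$ that is $C^\infty$ on an open neighbourhood $U$ of $\overline\Omega$, with $\Omega=\{z\in U:\tilde\varrho(z)<0\}$ and $d\tilde\varrho\neq0$ at every point of $\partial\Omega$. A bounded plurisubharmonic exhaustion function for $\Omega$ is a function $\lambda$ that is continuous on $\overline\Omega$, strictly plurisubharmonic on $\Omega$ (that is, $C^2$ with positive definite Levi form $\sum_{j,k}\frac{\partial^2\lambda}{\partial z_j\partial\bar z_k}v_j\bar v_k$), zero on $\partial\Omega$, negative on $\Omega$, and such that $\{z\in\Omega:\lambda(z)<c\}$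 is relatively compact in $\Omega$ for every $c<0$. **Theorem.** For every $\delta_0>0$ there exists $\mu_0>0$ such that for all $\mu\ge\mu_0$ and every worm $\mathcal W_\mu$ with parameter $\mu$ (that is, every $\eta$ as above) the following holds: if $\tilde\varrho$ is a defining function for $\mathcal W_\mu$ and $\delta>0$ is such that $-(-\tilde\varrho)^\delta$ is a bounded plurisubharmonic exhaustion function for $\mathcal W_\mu$, then $\delta<\delta_0$. More precisely, for every $\mu>0$, every worm $\mathcal W_\mu$ with parameter $\mu$, every defining function $\tilde\varrho$ for $\mathcal W_\mu$ and every $\delta>0$ such that $-(-\tilde\varrho)^\delta$ is a bounded plurisubharmonic exhaustion function for $\mathcal W_\mu$, one has $\delta<\nu=\pi/(2\mu)$. -/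

import Mathlib

open Set
open scoped ContDiff

/-- The conditions (i)-(iv) on the function `η` that enters the definition of the worm with
parameter `μ`. (Where `η x = 1`, a nonzero `deriv` includes differentiability at `x`.) -/
structure IsWormProfile (μ : ℝ) (η : ℝ → ℝ) : Prop where
  nonneg : ∀ x, 0 ≤ η x
  even : Function.Even η
  convex : ConvexOn ℝ univ η
  zero_set : η ⁻¹' {0} = Icc (-μ) μ
  large : ∃ a : ℝ, 0 < a ∧ ∀ x, a < |x| → 1 < η x
  deriv_ne : ∀ x, η x = 1 → deriv η x ≠ 0

/-- The worm `{(z₁, z₂) : |z₁ - exp (i log |z₂|²)|² < 1 - η (log |z₂|²)}` in `ℂ²`.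
The points with `z₂ = 0`, where `log |z₂|²` is undefined, are excluded explicitly. -/
def worm (η : ℝ → ℝ) : Set (ℂ × ℂ) :=
  {z | z.2 ≠ 0 ∧
    ‖z.1 - Complex.exp (Complex.I * (Real.log (‖z.2‖ ^ 2) : ℝ))‖ ^ 2
      < 1 - η (Real.log (‖z.2‖ ^ 2))}

/-- `r` is a (smooth) defining function of `Ω`: it is `C^∞` on an open neighbourhood `U` of the
closure of `Ω`, `Ω` is the part of `U` where `r < 0`, and the differential of `r` vanishes
nowhere on the boundary. (It follows that `r = 0` on the boundary.) -/
def IsDefiningFunction (r : ℂ × ℂ → ℝ) (Ω : Set (ℂ × ℂ)) : Prop :=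
  ∃ U : Set (ℂ × ℂ), IsOpen U ∧ closure Ω ⊆ U ∧ ContDiffOn ℝ ∞ r U ∧
    Ω = {z | z ∈ U ∧ r z < 0} ∧ ∀ p ∈ frontier Ω, fderiv ℝ r p ≠ 0

/-- The Levi form (complex Hessian) `∑ⱼₖ ∂²u/∂zⱼ∂z̄ₖ (p) vⱼ v̄ₖ`, written through the real second
derivative as `(D²u(p)(v, v) + D²u(p)(iv, iv)) / 4`. -/
noncomputable def leviForm (u : ℂ × ℂ → ℝ) (p v : ℂ × ℂ) : ℝ :=
  (iteratedFDeriv ℝ 2 u p ![v, v]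
    + iteratedFDeriv ℝ 2 u p ![Complex.I • v, Complex.I • v]) / 4

/-- Strict plurisubharmonicity on an open set: `u` is of class `C²` with positive definite
Levi form. -/
def StrictlyPlurisubharmonicOn (u : ℂ × ℂ → ℝ) (Ω : Set (ℂ × ℂ)) : Prop :=
  ContDiffOn ℝ 2 u Ω ∧ ∀ p ∈ Ω, ∀ v : ℂ × ℂ, v ≠ 0 → 0 < leviForm u p v

/-- Bounded plurisubharmonic exhaustion functions `u` of a domain `Ω` in `ℂ²`. -/
structure IsBoundedPshExhaustion (u : ℂ × ℂ → ℝ) (Ω : Set (ℂ × ℂ)) : Prop where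
  continuousOn : ContinuousOn u (closure Ω)
  strictlyPsh : StrictlyPlurisubharmonicOn u Ω
  boundary : ∀ z ∈ frontier Ω, u z = 0
  neg : ∀ z ∈ Ω, u z < 0
  exhaustion : ∀ c : ℝ, c < 0 →
    IsCompact (closure {z | z ∈ Ω ∧ u z < c}) ∧ closure {z | z ∈ Ω ∧ u z < c} ⊆ Ω

open Set Filter Topology
open scoped ContDiff

/-! The boundary of the worm contains the annulus `z₁ = 0`, `|log |z₂|²| ≤ μ`, and the disc slices
over it turn with `log |z₂|²`. The holomorphic curves `z₁ = ε z₂ ^ (2 i)` turn with them: in the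
coordinate `w = log z₂` they leave the annulus exactly along the axis of each disc, at speed `exp
(-2 Im w)`. Write `u = -(-r)^δ` and `h = axisRate r`, which is positive and has period `2πi`. As `ε
→ 0`, the superharmonic functions `-u / ε^δ` on these curves tend to `F = exp (-2δ Im w) h^δ`
(`tendsto_neg_div`).

Suppose `δ ≥ π / (2μ)`. For `β < δ` the function `T = exp (-2δ Im w) cos (2β Re w)` is strictly
subharmonic where the cosine is positive. On the strip `|2 Re w| ≤ π / (2δ)`, which lies over the
annulus, some multiple `c T` with `β` close to `δ` touches `F` from below at an interior point
(`exists_touching_cos`). A superharmonic function cannot be so touched. Since `F` is only a limit,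
`exponent_lt` perturbs the contact by a quadratic penalty and applies the second derivative test on
a curve with `ε > 0`. -/

/-! ### Second derivatives along curves. -/

/-- The necessary second derivative test at a local minimum. -/
theorem IsLocalMin.second_deriv_nonneg {φ φ' : ℝ → ℝ} {x b : ℝ} (h : IsLocalMin φ x)
    (h1 : ∀ᶠ t in 𝓝 x, HasDerivAt φ (φ' t) t) (h2 : HasDerivAt φ' b x) : 0 ≤ b := by
  by_contra! hb
  have hd : deriv φ =ᶠ[𝓝 x] φ' := h1.mono fun t ht => ht.deriv
  have hdd : deriv (deriv φ) x = b := by rw [hd.deriv_eq, h2.deriv]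
  -- With `b < 0` the point would also be a local maximum, so `φ` would be locally constant and `b =
  -- 0`.
  have hmax : IsLocalMax φ x :=
    isLocalMax_of_deriv_deriv_neg (by rw [hdd]; exact hb) h.deriv_eq_zero h1.self_of_nhds.continuousAt
  have hc : φ =ᶠ[𝓝 x] fun _ => φ x := by
    filter_upwards [h, hmax] with t h1 h2 using le_antisymm h2 h1
  have : deriv (deriv φ) x = 0 := by
    rw [hc.deriv.deriv_eq]; simp
  linarith

/-- The first and second derivatives of a `C²` function along a curve. -/
theorem ContDiffAt.second_deriv_comp_curve {E : Type*} [NormedAddCommGroup E] [NormedSpace ℝ E]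
    {u : E → ℝ} {γ γ' : ℝ → E} {x : ℝ} {c : E} (hu : ContDiffAt ℝ 2 u (γ x))
    (h1 : ∀ t, HasDerivAt γ (γ' t) t) (h2 : HasDerivAt γ' c x) :
    (∀ᶠ t in 𝓝 x, HasDerivAt (fun t => u (γ t)) (fderiv ℝ u (γ t) (γ' t)) t) ∧
      HasDerivAt (fun t => fderiv ℝ u (γ t) (γ' t))
        (iteratedFDeriv ℝ 2 u (γ x) ![γ' x, γ' x] + fderiv ℝ u (γ x) c) x := by
  constructor
  · have h := (h1 x).continuousAt.eventually (hu.eventually (by simp))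
    filter_upwards [h] with t ht
    exact (ht.differentiableAt (by simp)).hasFDerivAt.comp_hasDerivAt t (h1 t)
  · have hd : DifferentiableAt ℝ (fderiv ℝ u) (γ x) :=
      (hu.fderiv_right (m := 1) (by norm_num)).differentiableAt (by simp)
    have := (hd.hasFDerivAt.comp_hasDerivAt x (h1 x)).clm_apply h2
    rw [iteratedFDeriv_two_apply]
    exact this

/-! ### Geometry of the worm over the critical annulus. -/

/-- The unit vector along which the slice of the worm over `z₂` leaves the origin. -/
noncomputable def wormAxis (z : ℂ) : ℂ :=
  Complex.exp (Complex.I * (Real.log (‖z‖ ^ 2) : ℝ))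

theorem norm_wormAxis (z : ℂ) : ‖wormAxis z‖ = 1 := by
  rw [wormAxis, mul_comm, Complex.norm_exp_ofReal_mul_I]

theorem log_norm_exp_sq (w : ℂ) : Real.log (‖Complex.exp w‖ ^ 2) = 2 * w.re := by
  rw [Complex.norm_exp, Real.log_pow, Real.log_exp]; norm_num

/-- This is why the exponent `2 i` is chosen: the curve stays on the positive ray through the axis
of each slice. -/
theorem wormAxis_exp (w : ℂ) :
    Complex.exp (2 * Complex.I * w) = (Real.exp (-2 * w.im) : ℝ) * wormAxis (Complex.exp w) := by
  rw [wormAxis, log_norm_exp_sq, Complex.ofReal_exp, ← Complex.exp_add]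
  congr 1
  apply Complex.ext <;> simp 

theorem continuousAt_wormAxis {z : ℂ} (hz : z ≠ 0) : ContinuousAt wormAxis z := by
  unfold wormAxis
  have : ‖z‖ ^ 2 ≠ 0 := by simpa using hz
  have h2 : ContinuousAt (fun z : ℂ => Real.log (‖z‖ ^ 2)) z :=
    ContinuousAt.log (by fun_prop) this
  exact Complex.continuous_exp.continuousAt.comp
    (continuousAt_const.mul (Complex.continuous_ofReal.continuousAt.comp h2))

/-- Over the critical annulus, the slices of the worm are discs with the origin on their
boundary. -/
theorem IsWormProfile.mem_worm_iff {μ : ℝ} {η : ℝ → ℝ} (hη : IsWormProfile μ η) {z : ℂ × ℂ}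
    (h0 : z.2 ≠ 0) (hz : |Real.log (‖z.2‖ ^ 2)| ≤ μ) :
    z ∈ worm η ↔ ‖z.1 - wormAxis z.2‖ ^ 2 < 1 := by
  have : η (Real.log (‖z.2‖ ^ 2)) = 0 := by
    have : Real.log (‖z.2‖ ^ 2) ∈ η ⁻¹' {0} := by
      rw [hη.zero_set]; exact abs_le.1 hz
    exact this
  rw [worm, mem_ofPred_eq, this, sub_zero, wormAxis]
  exact and_iff_right h0

/-- Small positive multiples of vectors on the inner side of the tangent line lie in the slice. -/
theorem IsWormProfile.eventually_mem_worm {μ : ℝ} {η : ℝ → ℝ} (hη : IsWormProfile μ η) {z v : ℂ}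
    (h0 : z ≠ 0) (hz : |Real.log (‖z‖ ^ 2)| ≤ μ) (hv : 0 < (v * starRingEnd ℂ (wormAxis z)).re) :
    ∀ᶠ t : ℝ in 𝓝[>] 0, ((t : ℂ) * v, z) ∈ worm η := by
  have hc : ∀ᶠ t : ℝ in 𝓝[>] 0, t * ‖v‖ ^ 2 < 2 * (v * starRingEnd ℂ (wormAxis z)).re := by
    have : Tendsto (fun t : ℝ => t * ‖v‖ ^ 2) (𝓝[>] 0) (𝓝 (0 * ‖v‖ ^ 2)) :=
      ((continuous_id.mul continuous_const).tendsto 0).mono_left nhdsWithin_le_nhds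
    exact this.eventually_lt_const (by simpa using hv)
  filter_upwards [hc, self_mem_nhdsWithin] with t ht ht0
  rw [hη.mem_worm_iff (z := ((t : ℂ) * v, z)) h0 hz]
  have e : ‖(t : ℂ) * v - wormAxis z‖ ^ 2
      = t * (t * ‖v‖ ^ 2 - 2 * (v * starRingEnd ℂ (wormAxis z)).re) + 1 := by
    have h2 : ‖wormAxis z‖ ^ 2 = 1 := by rw [norm_wormAxis]; norm_num
    rw [Complex.sq_norm, Complex.normSq_apply] at h2 ⊢
    rw [Complex.sq_norm, Complex.normSq_apply]
    simp
    linear_combination h2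
  simp only [e]
  have := mul_neg_of_pos_of_neg (mem_Ioi.1 ht0) (sub_neg.2 ht)
  linarith

theorem IsWormProfile.zero_mem_frontier {μ : ℝ} {η : ℝ → ℝ} (hη : IsWormProfile μ η) {z : ℂ}
    (h0 : z ≠ 0) (hz : |Real.log (‖z‖ ^ 2)| ≤ μ) : ((0 : ℂ), z) ∈ frontier (worm η) := by
  refine ⟨?_, fun h => ?_⟩
  · have hv : 0 < (wormAxis z * starRingEnd ℂ (wormAxis z)).re := by
      rw [Complex.mul_conj, Complex.normSq_eq_norm_sq, norm_wormAxis]; norm_num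
    have ht : Tendsto (fun t : ℝ => ((t : ℂ) * wormAxis z, z)) (𝓝[>] 0) (𝓝 ((0 : ℂ), z)) := by
      have : ContinuousAt (fun t : ℝ => ((t : ℂ) * wormAxis z, z)) 0 := by fun_prop
      simpa [ContinuousAt] using this.mono_left (nhdsWithin_le_nhds (s := Ioi 0))
    exact mem_closure_of_tendsto ht (hη.eventually_mem_worm h0 hz hv)
  · have := (hη.mem_worm_iff (z := ((0 : ℂ), z)) h0 hz).1 (interior_subset h)
    simp [norm_wormAxis] at this

/-! ### Defining functions along the critical annulus. -/

theorem IsDefiningFunction.isOpen {r : ℂ × ℂ → ℝ} {Ω : Set (ℂ × ℂ)} (h : IsDefiningFunction r Ω) :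
    IsOpen Ω := by
  obtain ⟨U, hU, -, hr, hΩ, -⟩ := h
  rw [hΩ]
  exact hr.continuousOn.isOpen_inter_preimage hU isOpen_Iio

theorem IsDefiningFunction.contDiffAt {r : ℂ × ℂ → ℝ} {Ω : Set (ℂ × ℂ)}
    (h : IsDefiningFunction r Ω) {p : ℂ × ℂ} (hp : p ∈ closure Ω) : ContDiffAt ℝ ∞ r p := by
  obtain ⟨U, hU, hcl, hr, -, -⟩ := h
  exact hr.contDiffAt (hU.mem_nhds (hcl hp))

theorem IsDefiningFunction.neg {r : ℂ × ℂ → ℝ} {Ω : Set (ℂ × ℂ)}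
    (h : IsDefiningFunction r Ω) {p : ℂ × ℂ} (hp : p ∈ Ω) : r p < 0 := by
  obtain ⟨U, -, -, -, hΩ, -⟩ := h
  rw [hΩ] at hp
  exact hp.2

theorem IsDefiningFunction.eq_zero {r : ℂ × ℂ → ℝ} {Ω : Set (ℂ × ℂ)}
    (h : IsDefiningFunction r Ω) {p : ℂ × ℂ} (hp : p ∈ frontier Ω) : r p = 0 := by
  have hc := (h.contDiffAt hp.1).continuousAt
  have hle : r p ≤ 0 := by
    have : (𝓝[Ω] p).NeBot := mem_closure_iff_nhdsWithin_neBot.1 hp.1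
    refine le_of_tendsto (hc.mono_left (nhdsWithin_le_nhds (s := Ω))) ?_
    filter_upwards [self_mem_nhdsWithin] with q hq using (h.neg hq).le
  have hn : p ∉ Ω := fun hm => hp.2 (by rwa [h.isOpen.interior_eq])
  obtain ⟨U, -, hcl, -, hΩ, -⟩ := h
  refine le_antisymm hle (not_lt.1 fun hlt => hn ?_)
  rw [hΩ]
  exact ⟨hcl hp.1, hlt⟩

theorem HasDerivAt.nonpos_of_eventually_nonpos_right {g : ℝ → ℝ} {b : ℝ} (hd : HasDerivAt g b 0)
    (h0 : g 0 = 0) (hg : ∀ᶠ t in 𝓝[>] 0, g t ≤ 0) : b ≤ 0 := by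
  have := hasDerivAt_iff_tendsto_slope_zero.1 hd
  have h2 := this.mono_left (nhdsWithin_mono (0:ℝ) (fun x (hx : x ∈ Ioi (0:ℝ)) => ne_of_gt hx))
  refine le_of_tendsto h2 ?_
  filter_upwards [hg, self_mem_nhdsWithin] with t ht ht0
  simp only [zero_add, h0, sub_zero, smul_eq_mul]
  exact mul_nonpos_of_nonneg_of_nonpos (inv_nonneg.2 (le_of_lt ht0)) ht

variable {μ : ℝ} {η : ℝ → ℝ} {r : ℂ × ℂ → ℝ}

theorem abs_log_le_of {w : ℂ} (h : |2 * w.re| ≤ μ) : |Real.log (‖Complex.exp w‖ ^ 2)| ≤ μ := by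
  rwa [log_norm_exp_sq]

/-- A defining function of the worm has negative derivative at `(0, z₂)` in the direction of the
axis. -/
theorem IsDefiningFunction.fderiv_wormAxis_neg (hμ : 0 < μ) (hη : IsWormProfile μ η)
    (hr : IsDefiningFunction r (worm η)) {z : ℂ} (h0 : z ≠ 0) (hz : |Real.log (‖z‖ ^ 2)| ≤ μ) :
    fderiv ℝ r (0, z) (wormAxis z, 0) < 0 := by
  have hfr := hη.zero_mem_frontier h0 hz
  have hD : HasFDerivAt r (fderiv ℝ r (0, z)) (0, z) :=
    ((hr.contDiffAt hfr.1).differentiableAt (by simp)).hasFDerivAt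
  have hne : fderiv ℝ r (0, z) ≠ 0 := by
    obtain ⟨U, -, -, -, -, h⟩ := id hr
    exact h _ hfr
  set D := fderiv ℝ r (0, z) with hDdef
  have hin : ∀ v : ℂ, 0 < (v * starRingEnd ℂ (wormAxis z)).re → D (v, 0) ≤ 0 := by
    intro v hv
    have hγ : HasDerivAt (fun t : ℝ => ((t : ℂ) * v, z)) (v, (0 : ℂ)) 0 := by
      have h1 := (Complex.ofRealCLM.hasDerivAt (x := (0 : ℝ))).mul_const v
      simpa using h1.prodMk (hasDerivAt_const (0 : ℝ) z)
    have hD' : HasFDerivAt r D ((fun t : ℝ => ((t : ℂ) * v, z)) 0) := by simpa using hD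
    refine (hD'.comp_hasDerivAt (0 : ℝ) hγ).nonpos_of_eventually_nonpos_right ?_ ?_
    · simpa using hr.eq_zero hfr
    · filter_upwards [hη.eventually_mem_worm h0 hz hv] with t ht using (hr.neg ht).le
  have hunit : wormAxis z * starRingEnd ℂ (wormAxis z) = 1 := by
    rw [Complex.mul_conj, Complex.normSq_eq_norm_sq, norm_wormAxis]; norm_num
  have hle : D (wormAxis z, 0) ≤ 0 := hin _ (by rw [hunit]; norm_num)
  -- If the axial derivative vanished, `D` would vanish on the slice and along the annulus, hence
  -- entirely.
  refine lt_of_le_of_ne hle fun heq => hne ?_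
  -- directions in the slice
  have hle' : ∀ y : ℝ, D (y * Complex.I * wormAxis z, 0) ≤ 0 := by
    intro y
    -- The vector stays in the open half-plane for every real `y`; using both signs of `y` later
    -- forces equality.
    have h1 := hin (wormAxis z + y * Complex.I * wormAxis z) (by
      rw [add_mul, mul_assoc _ (wormAxis z), hunit]; simp)
    have h2 : (wormAxis z + y * Complex.I * wormAxis z, (0 : ℂ))
      = (wormAxis z, 0) + (y * Complex.I * wormAxis z, 0) := by simp
    rw [h2, map_add, heq, zero_add] at h1
    exact h1
  have h1 : ∀ v : ℂ, D (v, 0) = 0 := by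
    intro v
    set q := v * starRingEnd ℂ (wormAxis z) with hq
    have hv : v = q.re * wormAxis z + q.im * Complex.I * wormAxis z := by
      rw [← add_mul, Complex.re_add_im, hq, mul_assoc, mul_comm (starRingEnd ℂ _), hunit, mul_one]
    have e1 : ((q.re : ℂ) * wormAxis z, (0 : ℂ)) = q.re • (wormAxis z, (0 : ℂ)) := by simp
    have e2 := hle' q.im
    have e3 := hle' (-q.im)
    have e4 : (((-q.im : ℝ) : ℂ) * Complex.I * wormAxis z, (0 : ℂ))
      = -((q.im : ℂ) * Complex.I * wormAxis z, (0 : ℂ)) := by simp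
    rw [e4, map_neg] at e3
    have e5 : (v, (0 : ℂ)) = ((q.re : ℂ) * wormAxis z, (0 : ℂ))
      + ((q.im : ℂ) * Complex.I * wormAxis z, (0 : ℂ)) := by
      rw [Prod.mk_add_mk, ← hv, add_zero]
    rw [e5, map_add, e1, map_smul, heq, smul_zero, zero_add]
    linarith
  -- directions along the annulus
  obtain ⟨w, rfl⟩ : ∃ w, Complex.exp w = z := ⟨_, Complex.exp_log h0⟩
  rw [log_norm_exp_sq] at hz
  have hcurve : ∀ a : ℂ, (∀ᶠ t : ℝ in 𝓝[>] 0, |2 * (w + t * a).re| ≤ μ) →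
      D (0, a * Complex.exp w) = 0 := by
    intro a ha
    have hγ : HasDerivAt (fun t : ℝ => ((0 : ℂ), Complex.exp (w + t * a)))
        ((0 : ℂ), a * Complex.exp w) 0 := by
      have h1 := ((Complex.ofRealCLM.hasDerivAt (x := (0 : ℝ))).mul_const a).const_add w
      simpa [mul_comm] using (hasDerivAt_const (0 : ℝ) (0 : ℂ)).prodMk h1.cexp
    have hD' : HasFDerivAt r D ((fun t : ℝ => ((0 : ℂ), Complex.exp (w + t * a))) 0) := by
      simpa using hD
    have hz : ∀ᶠ t : ℝ in 𝓝[>] 0, r ((0 : ℂ), Complex.exp (w + t * a)) = 0 := by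
      filter_upwards [ha] with t ht
      exact hr.eq_zero (hη.zero_mem_frontier (Complex.exp_ne_zero _) (abs_log_le_of ht))
    have hc := hD'.comp_hasDerivAt (0 : ℝ) hγ
    have h00 := hr.eq_zero hfr
    refine le_antisymm (hc.nonpos_of_eventually_nonpos_right (by simpa using h00) ?_) ?_
    · filter_upwards [hz] with t ht using ht.le
    · have := hc.neg.nonpos_of_eventually_nonpos_right (by simpa using h00) (by
        filter_upwards [hz] with t ht using (by simp [ht]))
      linarith
  have hI : D (0, Complex.I * Complex.exp w) = 0 := by
    refine hcurve _ (Eventually.of_forall fun t => ?_)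
    simpa using hz
  -- On an edge of the annulus only the inward radial direction stays in it, so the sign follows
  -- that of `w.re`.
  have hR : D (0, Complex.exp w) = 0 := by
    rcases le_total 0 w.re with hw | hw
    · have := hcurve (-1) (by
        have : ∀ᶠ t : ℝ in 𝓝[>] 0, t < μ / 2 :=
          nhdsWithin_le_nhds (gt_mem_nhds (by positivity))
        filter_upwards [this, self_mem_nhdsWithin] with t ht ht0
        have ht0 : 0 < t := ht0
        rw [abs_le] at hz ⊢
        simp
        constructor <;> linarith)
      have e : ((0 : ℂ), -1 * Complex.exp w) = -((0 : ℂ), Complex.exp w) := by simp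
      rw [e, map_neg] at this
      linarith
    · have := hcurve 1 (by
        have : ∀ᶠ t : ℝ in 𝓝[>] 0, t < μ / 2 :=
          nhdsWithin_le_nhds (gt_mem_nhds (by positivity))
        filter_upwards [this, self_mem_nhdsWithin] with t ht ht0
        have ht0 : 0 < t := ht0
        rw [abs_le] at hz ⊢
        simp
        constructor <;> linarith)
      simpa using this
  have h2 : ∀ v : ℂ, D (0, v) = 0 := by
    intro v
    set q := v / Complex.exp w with hq
    have hv : v = q.re • Complex.exp w + q.im • (Complex.I * Complex.exp w) := by
      rw [Complex.real_smul, Complex.real_smul, ← mul_assoc, ← add_mul, Complex.re_add_im, hq,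
        div_mul_cancel₀ _ (Complex.exp_ne_zero w)]
    have e5 : ((0 : ℂ), v) = q.re • ((0 : ℂ), Complex.exp w)
      + q.im • ((0 : ℂ), Complex.I * Complex.exp w) := by
      rw [Prod.smul_mk, Prod.smul_mk, Prod.mk_add_mk, ← hv]; simp
    rw [e5, map_add, map_smul, map_smul, hI, hR]
    simp
  refine ContinuousLinearMap.ext fun v => ?_
  have : v = (v.1, 0) + (0, v.2) := by simp
  rw [this, map_add, h1, h2]
  simp

/-! ### The comparison function, the holomorphic curves and the Laplacian test. -/

/-- The comparison function `exp (-2 α Im w) cos (2 β Re w)`, subharmonic where it is nonnegative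
provided `β ≤ α`. -/
noncomputable def expCos (α β : ℝ) (w : ℂ) : ℝ :=
  Real.exp (-2 * α * w.im) * Real.cos (2 * β * w.re)

theorem continuous_expCos (α β : ℝ) : Continuous (expCos α β) := by
  unfold expCos; fun_prop

/-- The entire curve `w ↦ (ε exp (2 i w), exp w)`, a branch of `z₁ = ε z₂ ^ (2 i)`. -/
noncomputable def wormCurve (ε : ℝ) (w : ℂ) : ℂ × ℂ :=
  (ε * Complex.exp (2 * Complex.I * w), Complex.exp w)

/-- The velocity of `wormCurve`. -/
noncomputable def wormCurveDeriv (ε : ℝ) (w : ℂ) : ℂ × ℂ :=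
  (ε * (2 * Complex.I * Complex.exp (2 * Complex.I * w)), Complex.exp w)

/-- The acceleration of `wormCurve`. -/
noncomputable def wormCurveDeriv2 (ε : ℝ) (w : ℂ) : ℂ × ℂ :=
  (ε * (2 * Complex.I * (2 * Complex.I * Complex.exp (2 * Complex.I * w))), Complex.exp w)

theorem hasDerivAt_line (w a : ℂ) (t : ℝ) : HasDerivAt (fun t : ℝ => w + t * a) a t := by
  simpa using ((Complex.ofRealCLM.hasDerivAt (x := t)).mul_const a).const_add w

theorem hasDerivAt_wormCurve (ε : ℝ) (w a : ℂ) (t : ℝ) :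
    HasDerivAt (fun t : ℝ => wormCurve ε (w + t * a)) (a • wormCurveDeriv ε (w + t * a)) t := by
  have h := hasDerivAt_line w a t
  have h1 := ((h.const_mul (2 * Complex.I)).cexp.const_mul (ε : ℂ)).prodMk h.cexp
  refine h1.congr_deriv ?_
  simp only [wormCurveDeriv, Prod.smul_mk, smul_eq_mul]
  congr 1 <;> ring

theorem hasDerivAt_wormCurveDeriv (ε : ℝ) (w a : ℂ) (t : ℝ) :
    HasDerivAt (fun t : ℝ => a • wormCurveDeriv ε (w + t * a))
      (a ^ 2 • wormCurveDeriv2 ε (w + t * a)) t := by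
  have h := hasDerivAt_line w a t
  have h1 := ((((h.const_mul (2 * Complex.I)).cexp.const_mul (2 * Complex.I)).const_mul
    (ε : ℂ)).prodMk h.cexp).const_smul a
  refine h1.congr_deriv ?_
  simp only [wormCurveDeriv2, Prod.smul_mk, smul_eq_mul]
  congr 1 <;> ring

/-- The derivative of `expCos` along the direction `a`. -/
noncomputable def expCosDeriv (α β : ℝ) (a w : ℂ) : ℝ :=
  Real.exp (-2 * α * w.im) * (-2 * α * a.im) * Real.cos (2 * β * w.re)
    + Real.exp (-2 * α * w.im) * (-Real.sin (2 * β * w.re) * (2 * β * a.re))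

theorem hasDerivAt_re_im_line (w a : ℂ) (t : ℝ) :
    HasDerivAt (fun t : ℝ => (w + t * a).re) a.re t ∧
      HasDerivAt (fun t : ℝ => (w + t * a).im) a.im t :=
  ⟨Complex.reCLM.hasFDerivAt.comp_hasDerivAt t (hasDerivAt_line w a t),
    Complex.imCLM.hasFDerivAt.comp_hasDerivAt t (hasDerivAt_line w a t)⟩

theorem hasDerivAt_expCos (α β : ℝ) (w a : ℂ) (t : ℝ) :
    HasDerivAt (fun t : ℝ => expCos α β (w + t * a)) (expCosDeriv α β a (w + t * a)) t := by
  obtain ⟨hr, hi⟩ := hasDerivAt_re_im_line w a t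
  exact (hi.const_mul (-2 * α)).exp.mul (hr.const_mul (2 * β)).cos

theorem hasDerivAt_expCosDeriv (α β : ℝ) (w a : ℂ) (t : ℝ) :
    HasDerivAt (fun t : ℝ => expCosDeriv α β a (w + t * a))
      (4 * (α ^ 2 * a.im ^ 2 - β ^ 2 * a.re ^ 2) * expCos α β (w + t * a)
        + 8 * α * β * a.re * a.im * Real.exp (-2 * α * (w + t * a).im)
          * Real.sin (2 * β * (w + t * a).re)) t := by
  obtain ⟨hr, hi⟩ := hasDerivAt_re_im_line w a t
  have he := (hi.const_mul (-2 * α)).exp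
  have hr' := hr.const_mul (2 * β)
  refine (((he.mul_const (-2 * α * a.im)).mul hr'.cos).add
    (he.mul (hr'.sin.neg.mul_const (2 * β * a.re)))).congr_deriv ?_
  simp only [expCos, Pi.neg_apply]
  ring

theorem hasDerivAt_normSq_line (w₁ w a : ℂ) (t : ℝ) :
    HasDerivAt (fun t : ℝ => Complex.normSq (w + t * a - w₁))
        (2 * ((w + t * a).re - w₁.re) * a.re + 2 * ((w + t * a).im - w₁.im) * a.im) t ∧
      HasDerivAt (fun t : ℝ =>
        2 * ((w + t * a).re - w₁.re) * a.re + 2 * ((w + t * a).im - w₁.im) * a.im)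
        (2 * (a.re ^ 2 + a.im ^ 2)) t := by
  obtain ⟨hr, hi⟩ := hasDerivAt_re_im_line w a t
  constructor
  · simp only [Complex.normSq_apply, Complex.sub_re, Complex.sub_im]
    refine (((hr.sub_const w₁.re).mul (hr.sub_const w₁.re)).add
      ((hi.sub_const w₁.im).mul (hi.sub_const w₁.im))).congr_deriv ?_
    ring
  · refine ((((hr.sub_const w₁.re).const_mul 2).mul_const a.re).add
      (((hi.sub_const w₁.im).const_mul 2).mul_const a.im)).congr_deriv ?_
    ring

/-- At a local minimum of a combination of a `C²` function along `wormCurve`, the comparison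
function and a quadratic penalty, the Laplacian of the combination is nonnegative. -/
theorem laplacian_nonneg_of_isLocalMin {u : ℂ × ℂ → ℝ} {A c κ α β ε : ℝ} {w w₁ : ℂ}
    (hu : ContDiffAt ℝ 2 u (wormCurve ε w))
    (hmin : IsLocalMin (fun w => A * u (wormCurve ε w) - c * expCos α β w
      + κ * Complex.normSq (w - w₁)) w) :
    0 ≤ A * leviForm u (wormCurve ε w) (wormCurveDeriv ε w)
      - c * (α ^ 2 - β ^ 2) * expCos α β w + κ := by
  have key : ∀ a : ℂ, 0 ≤ A * (iteratedFDeriv ℝ 2 u (wormCurve ε w)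
        ![a • wormCurveDeriv ε w, a • wormCurveDeriv ε w]
          + fderiv ℝ u (wormCurve ε w) (a ^ 2 • wormCurveDeriv2 ε w))
      - c * (4 * (α ^ 2 * a.im ^ 2 - β ^ 2 * a.re ^ 2) * expCos α β w
        + 8 * α * β * a.re * a.im * Real.exp (-2 * α * w.im) * Real.sin (2 * β * w.re))
      + κ * (2 * (a.re ^ 2 + a.im ^ 2)) := by
    intro a
    have e0 : w + ((0 : ℝ) : ℂ) * a = w := by simp
    have hline : Tendsto (fun t : ℝ => w + t * a) (𝓝 0) (𝓝 w) := by
      simpa [ContinuousAt] using (hasDerivAt_line w a 0).continuousAt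
    have hmin' : IsLocalMin (fun t : ℝ => A * u (wormCurve ε (w + t * a))
        - c * expCos α β (w + t * a) + κ * Complex.normSq (w + t * a - w₁)) 0 := by
      have := hline.eventually hmin
      unfold IsLocalMin IsMinFilter
      simpa only [e0] using this
    have hu' : ContDiffAt ℝ 2 u ((fun t : ℝ => wormCurve ε (w + t * a)) 0) := by
      simpa using hu
    obtain ⟨h1, h2⟩ := hu'.second_deriv_comp_curve (hasDerivAt_wormCurve ε w a)
      (hasDerivAt_wormCurveDeriv ε w a 0)
    have := hmin'.second_deriv_nonneg (h1.mono fun t ht => ((ht.const_mul A).sub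
        ((hasDerivAt_expCos α β w a t).const_mul c)).add
          ((hasDerivAt_normSq_line w₁ w a t).1.const_mul κ))
      (((h2.const_mul A).sub ((hasDerivAt_expCosDeriv α β w a 0).const_mul c)).add
          ((hasDerivAt_normSq_line w₁ w a 0).2.const_mul κ))
    simpa only [e0] using this
  -- Adding the directions `1` and `I` cancels the acceleration terms, as `1 + I ^ 2 = 0`; the mixed
  -- terms vanish in each. The sum is four times the claim.
  have h1 := key 1
  have hI := key Complex.I
  simp only [one_smul, one_pow, Complex.I_sq, neg_smul, map_neg, Complex.one_re, Complex.one_im,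
    Complex.I_re, Complex.I_im] at h1 hI
  unfold leviForm
  linarith

/-! ### Asymptotics of the defining function on the curves as `ε → 0`. -/

/-- The rate at which `-r` grows at `(0, exp w)` in the direction of the axis. -/
noncomputable def axisRate (r : ℂ × ℂ → ℝ) (w : ℂ) : ℝ :=
  -fderiv ℝ r (0, Complex.exp w) (wormAxis (Complex.exp w), 0)

theorem IsDefiningFunction.axisRate_pos (hμ : 0 < μ) (hη : IsWormProfile μ η)
    (hr : IsDefiningFunction r (worm η)) {w : ℂ} (hw : |2 * w.re| ≤ μ) : 0 < axisRate r w :=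
  neg_pos.2 (hr.fderiv_wormAxis_neg hμ hη (Complex.exp_ne_zero w) (abs_log_le_of hw))

theorem IsDefiningFunction.continuousAt_axisRate (hη : IsWormProfile μ η)
    (hr : IsDefiningFunction r (worm η)) {w : ℂ} (hw : |2 * w.re| ≤ μ) :
    ContinuousAt (axisRate r) w := by
  have h := hr.contDiffAt (hη.zero_mem_frontier (Complex.exp_ne_zero w) (abs_log_le_of hw)).1
  have hc : ContinuousAt (fderiv ℝ r) ((0 : ℂ), Complex.exp w) :=
    (h.fderiv_right (m := 0) (by simp)).continuousAt
  have hf : ContinuousAt (fun w : ℂ => ((0 : ℂ), Complex.exp w)) w := by fun_prop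
  have ha : ContinuousAt (fun w : ℂ => (wormAxis (Complex.exp w), (0 : ℂ))) w :=
    ((continuousAt_wormAxis (Complex.exp_ne_zero w)).comp
      Complex.continuous_exp.continuousAt).prodMk continuousAt_const
  exact ((ContinuousAt.comp (f := fun w : ℂ => ((0 : ℂ), Complex.exp w)) (g := fderiv ℝ r)
    hc hf).clm_apply ha).neg

theorem tendsto_wormCurve (w : ℂ) :
    Tendsto (fun p : ℂ × ℝ => wormCurve p.2 p.1) (𝓝 w ×ˢ 𝓝[>] 0) (𝓝 (0, Complex.exp w)) := by
  have h : Continuous fun p : ℂ × ℝ => wormCurve p.2 p.1 := by unfold wormCurve; fun_prop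
  have h2 := h.tendsto (w, 0)
  rw [nhds_prod_eq] at h2
  simpa [wormCurve] using
    h2.mono_left (Filter.prod_mono_right (𝓝 w) (nhdsWithin_le_nhds (s := Ioi 0)))

/-- Since `r` vanishes on the annulus, only the first-order term in `ε` survives. Strict
differentiability lets the base point move with `w`, so the limit is joint in `(w, ε)`, as needed
for uniformity on compact sets. -/
theorem IsDefiningFunction.tendsto_neg_div (hη : IsWormProfile μ η)
    (hr : IsDefiningFunction r (worm η)) {w : ℂ} (hw : |2 * w.re| < μ) :
    Tendsto (fun p : ℂ × ℝ => -r (wormCurve p.2 p.1) / p.2) (𝓝 w ×ˢ 𝓝[>] 0)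
      (𝓝 (Real.exp (-2 * w.im) * axisRate r w)) := by
  have hfr := hη.zero_mem_frontier (Complex.exp_ne_zero w) (abs_log_le_of hw.le)
  have hs : HasStrictFDerivAt r (fderiv ℝ r (0, Complex.exp w)) (0, Complex.exp w) :=
    (hr.contDiffAt hfr.1).hasStrictFDerivAt (by simp)
  set D := fderiv ℝ r (0, Complex.exp w) with hD
  have hfst : Tendsto (fun p : ℂ × ℝ => p.1) (𝓝 w ×ˢ 𝓝[>] 0) (𝓝 w) := tendsto_fst
  have hpos : ∀ᶠ p : ℂ × ℝ in 𝓝 w ×ˢ 𝓝[>] 0, 0 < p.2 :=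
    tendsto_snd.eventually self_mem_nhdsWithin
  have hbase : Tendsto (fun p : ℂ × ℝ => ((0 : ℂ), Complex.exp p.1)) (𝓝 w ×ˢ 𝓝[>] 0)
      (𝓝 (0, Complex.exp w)) :=
    tendsto_const_nhds.prodMk_nhds ((Complex.continuous_exp.tendsto w).comp hfst)
  have ho := hs.isLittleO.comp_tendsto ((tendsto_wormCurve w).prodMk_nhds hbase)
  have hE : Tendsto (fun p : ℂ × ℝ => Complex.exp (2 * Complex.I * p.1)) (𝓝 w ×ˢ 𝓝[>] 0)
      (𝓝 (Complex.exp (2 * Complex.I * w))) :=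
    ((by fun_prop : Continuous fun w : ℂ => Complex.exp (2 * Complex.I * w)).tendsto w).comp hfst
  have ediff : ∀ p : ℂ × ℝ, wormCurve p.2 p.1 - ((0 : ℂ), Complex.exp p.1)
      = p.2 • (Complex.exp (2 * Complex.I * p.1), (0 : ℂ)) := by
    intro p; simp [wormCurve]
  have hO : (fun p : ℂ × ℝ => wormCurve p.2 p.1 - ((0 : ℂ), Complex.exp p.1))
      =O[𝓝 w ×ˢ 𝓝[>] 0] fun p => p.2 := by
    simp only [ediff]
    have h1 : (fun p : ℂ × ℝ => (Complex.exp (2 * Complex.I * p.1), (0 : ℂ)))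
        =O[𝓝 w ×ˢ 𝓝[>] 0] fun _ => (1 : ℝ) := (hE.prodMk_nhds tendsto_const_nhds).isBigO_one ℝ
    simpa using (Asymptotics.isBigO_refl (fun p : ℂ × ℝ => p.2) (𝓝 w ×ˢ 𝓝[>] 0)).smul h1
  have h0 := (ho.trans_isBigO hO).tendsto_div_nhds_zero
  have hDlim : Tendsto (fun p : ℂ × ℝ => D (Complex.exp (2 * Complex.I * p.1), 0))
      (𝓝 w ×ˢ 𝓝[>] 0) (𝓝 (D (Complex.exp (2 * Complex.I * w), 0))) :=
    (D.continuous.tendsto _).comp (hE.prodMk_nhds tendsto_const_nhds)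
  have hlim := (h0.add hDlim).neg
  have eval : -(0 + D (Complex.exp (2 * Complex.I * w), 0))
      = Real.exp (-2 * w.im) * axisRate r w := by
    have e : (Complex.exp (2 * Complex.I * w), (0 : ℂ))
        = Real.exp (-2 * w.im) • (wormAxis (Complex.exp w), (0 : ℂ)) := by
      rw [wormAxis_exp, Prod.smul_mk, Complex.real_smul, smul_zero]
    rw [e, map_smul, axisRate, smul_eq_mul, ← hD]
    ring
  rw [eval] at hlim
  refine hlim.congr' ?_
  have hre : ∀ᶠ p : ℂ × ℝ in 𝓝 w ×ˢ 𝓝[>] 0, |2 * p.1.re| < μ :=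
    hfst.eventually (((by fun_prop : Continuous fun w : ℂ => |2 * w.re|).tendsto
      w).eventually_lt_const hw)
  filter_upwards [hpos, hre] with p hp hpre
  have hr0 : r ((0 : ℂ), Complex.exp p.1) = 0 :=
    hr.eq_zero (hη.zero_mem_frontier (Complex.exp_ne_zero _) (abs_log_le_of hpre.le))
  simp only [Function.comp, ediff, hr0, map_smul, smul_eq_mul, sub_zero]
  field_simp
  ring

/-- Points of the curve with small parameter lie in the worm. -/
theorem IsWormProfile.eventually_wormCurve_mem (hη : IsWormProfile μ η) {w : ℂ}
    (hw : |2 * w.re| < μ) :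
    ∀ᶠ p : ℂ × ℝ in 𝓝 w ×ˢ 𝓝[>] 0, wormCurve p.2 p.1 ∈ worm η := by
  have hfst : Tendsto (fun p : ℂ × ℝ => p.1) (𝓝 w ×ˢ 𝓝[>] 0) (𝓝 w) := tendsto_fst
  have hsnd : Tendsto (fun p : ℂ × ℝ => p.2) (𝓝 w ×ˢ 𝓝[>] 0) (𝓝 0) :=
    tendsto_snd.mono_right nhdsWithin_le_nhds
  have hpos : ∀ᶠ p : ℂ × ℝ in 𝓝 w ×ˢ 𝓝[>] 0, 0 < p.2 :=
    tendsto_snd.eventually self_mem_nhdsWithin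
  have hre : ∀ᶠ p : ℂ × ℝ in 𝓝 w ×ˢ 𝓝[>] 0, |2 * p.1.re| < μ :=
    hfst.eventually (((by fun_prop : Continuous fun w : ℂ => |2 * w.re|).tendsto
      w).eventually_lt_const hw)
  -- The first coordinate is `t` times the unit axis, and `(t - 1) ^ 2 < 1` means `0 < t < 2`.
  have hsm : ∀ᶠ p : ℂ × ℝ in 𝓝 w ×ˢ 𝓝[>] 0, p.2 * Real.exp (-2 * p.1.im) < 2 := by
    have h := hsnd.mul (((by fun_prop : Continuous fun w : ℂ =>
      Real.exp (-2 * w.im)).tendsto w).comp hfst)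
    exact h.eventually_lt_const (by simp)
  filter_upwards [hpos, hre, hsm] with p hp hpre hps
  rw [hη.mem_worm_iff (z := wormCurve p.2 p.1) (Complex.exp_ne_zero _) (abs_log_le_of hpre.le)]
  simp only [wormCurve]
  have e : (p.2 : ℂ) * Complex.exp (2 * Complex.I * p.1) - wormAxis (Complex.exp p.1)
      = ((p.2 * Real.exp (-2 * p.1.im) - 1 : ℝ) : ℂ) * wormAxis (Complex.exp p.1) := by
    rw [wormAxis_exp]; push_cast; ring
  rw [e, norm_mul, norm_wormAxis, mul_one, Complex.norm_real, Real.norm_eq_abs, sq_abs]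
  have := mul_pos hp (Real.exp_pos (-2 * p.1.im))
  nlinarith

/-- A tube-lemma argument, used to choose one `ε` for a whole ball or sphere of `w`. -/
theorem IsCompact.eventually_forall_of_forall_eventually_prod {X Y : Type*} [TopologicalSpace X]
    {K : Set X} (hK : IsCompact K) {l : Filter Y} {P : X → Y → Prop}
    (h : ∀ x ∈ K, ∀ᶠ p : X × Y in 𝓝 x ×ˢ l, P p.1 p.2) : ∀ᶠ y in l, ∀ x ∈ K, P x y := by
  have h1 : {p : X × Y | P p.1 p.2} ∈ 𝓝ˢ K ×ˢ l := hK.mem_nhdsSet_prod_of_forall h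
  obtain ⟨U, hU, V, hV, hUV⟩ := mem_prod_iff.1 h1
  filter_upwards [hV] with y hy x hx
  exact hUV (mk_mem_prod (subset_of_mem_nhdsSet hU hx) hy)

/-! ### Touching from below and the contradiction. -/

/-- A power of the axis rate of the worm is touched from below over the strip `|2 Re w| ≤ s`,
at an interior point, by a multiple of a cosine of frequency `β` less than `δ = π / (2 s)`. -/
theorem IsDefiningFunction.exists_touching_cos (hμ : 0 < μ) (hη : IsWormProfile μ η)
    (hr : IsDefiningFunction r (worm η)) {δ : ℝ} (hδ : 0 < δ) (hs : Real.pi / (2 * δ) ≤ μ) :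
    ∃ β c : ℝ, ∃ w₁ : ℂ, 0 < β ∧ β < δ ∧ 0 < c ∧ |2 * w₁.re| < Real.pi / (2 * δ) ∧
      axisRate r w₁ ^ δ = c * Real.cos (2 * β * w₁.re) ∧
      ∀ w : ℂ, |2 * w.re| ≤ Real.pi / (2 * δ) →
        0 < Real.cos (2 * β * w.re) ∧ c * Real.cos (2 * β * w.re) ≤ axisRate r w ^ δ := by
  set s := Real.pi / (2 * δ) with hsdef
  have hs0 : 0 < s := by positivity
  have hδs : δ * s = Real.pi / 2 := by rw [hsdef]; field_simp
  -- `axisRate r w` depends only on `exp w`, so one period in `Im w` represents the whole strip by a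
  -- compact set.
  set Q : Set ℂ := Icc (-(s / 2)) (s / 2) ×ℂ Icc (-Real.pi) Real.pi with hQ
  have hQc : IsCompact Q := isCompact_Icc.reProdIm isCompact_Icc
  have hQre : ∀ w ∈ Q, |2 * w.re| ≤ s := by
    intro w hw
    have := (Complex.mem_reProdIm.1 hw).1
    rw [abs_le]; constructor <;> linarith [this.1, this.2]
  have h0Q : (0 : ℂ) ∈ Q := by
    rw [hQ, Complex.mem_reProdIm]
    simp [(half_pos hs0).le, Real.pi_pos.le]
  have hpos : ∀ w ∈ Q, 0 < axisRate r w ^ δ := fun w hw =>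
    Real.rpow_pos_of_pos (hr.axisRate_pos hμ hη ((hQre w hw).trans hs)) δ
  have hcont : ContinuousOn (fun w => axisRate r w ^ δ) Q := fun w hw =>
    ((hr.continuousAt_axisRate hη ((hQre w hw).trans hs)).rpow_const
      (Or.inr hδ.le)).continuousWithinAt
  obtain ⟨w₀, hw₀, hmin₀⟩ := hQc.exists_isMinOn ⟨0, h0Q⟩ hcont
  -- As `cos (δ s) = 0`, a `β` just below `δ` makes the cosine so small at the edges that the
  -- quotient there exceeds its value at `0`.
  obtain ⟨β, hβ, hβ0, hβδ⟩ : ∃ β : ℝ, Real.cos (β * s) * axisRate r 0 ^ δ < axisRate r w₀ ^ δ ∧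
      0 < β ∧ β < δ := by
    have h1 : Tendsto (fun β : ℝ => Real.cos (β * s) * axisRate r 0 ^ δ) (𝓝[<] δ)
        (𝓝 (Real.cos (δ * s) * axisRate r 0 ^ δ)) :=
      ((by fun_prop : Continuous fun β : ℝ =>
        Real.cos (β * s) * axisRate r 0 ^ δ).tendsto δ).mono_left nhdsWithin_le_nhds
    rw [hδs, Real.cos_pi_div_two, zero_mul] at h1
    have h2 := h1.eventually_lt_const (hpos w₀ hw₀)
    have h3 : ∀ᶠ β : ℝ in 𝓝[<] δ, 0 < β := nhdsWithin_le_nhds (lt_mem_nhds hδ)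
    exact (h2.and (h3.and self_mem_nhdsWithin)).exists
  have hβs : β * s < Real.pi / 2 := by rw [← hδs]; exact mul_lt_mul_of_pos_right hβδ hs0
  have hcos : ∀ w : ℂ, |2 * w.re| ≤ s → 0 < Real.cos (2 * β * w.re) := by
    intro w hw
    have h1 : |2 * β * w.re| ≤ β * s := by
      have e : 2 * β * w.re = β * (2 * w.re) := by ring
      rw [e, abs_mul, abs_of_pos hβ0]
      exact mul_le_mul_of_nonneg_left hw hβ0.le
    have := abs_le.1 h1
    exact Real.cos_pos_of_mem_Ioo ⟨by linarith, by linarith⟩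
  obtain ⟨w₁, hw₁, hmin₁⟩ := hQc.exists_isMinOn ⟨0, h0Q⟩
    (f := fun w => axisRate r w ^ δ / Real.cos (2 * β * w.re))
    (hcont.div (by fun_prop) fun w hw => (hcos w (hQre w hw)).ne')
  have hc1 := hcos w₁ (hQre w₁ hw₁)
  refine ⟨β, axisRate r w₁ ^ δ / Real.cos (2 * β * w₁.re), w₁, hβ0, hβδ,
    div_pos (hpos w₁ hw₁) hc1, ?_, (div_mul_cancel₀ _ hc1.ne').symm, fun w hw => ⟨hcos w hw, ?_⟩⟩
  · refine lt_of_le_of_ne (hQre w₁ hw₁) fun heq => ?_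
    have e : Real.cos (2 * β * w₁.re) = Real.cos (β * s) := by
      rw [← Real.cos_abs]
      congr 1
      have e : 2 * β * w₁.re = β * (2 * w₁.re) := by ring
      rw [e, abs_mul, heq, abs_of_pos hβ0]
    have h1 : axisRate r w₁ ^ δ / Real.cos (2 * β * w₁.re) ≤ axisRate r 0 ^ δ := by
      simpa using hmin₁ h0Q
    rw [div_le_iff₀ hc1, e] at h1
    have h2 : axisRate r w₀ ^ δ ≤ axisRate r w₁ ^ δ := hmin₀ hw₁
    linarith
  -- The principal logarithm moves `w` into `Q` without changing `exp w` or `Re w`.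
  · set w' := Complex.log (Complex.exp w) with hw'
    have hexp : Complex.exp w' = Complex.exp w := Complex.exp_log (Complex.exp_ne_zero w)
    have hre : w'.re = w.re := by
      rw [hw', Complex.log_re, Complex.norm_exp, Real.log_exp]
    have hrate : axisRate r w' = axisRate r w := by rw [axisRate, axisRate, hexp]
    have hw'Q : w' ∈ Q := by
      rw [hQ, Complex.mem_reProdIm, hre]
      have := abs_le.1 hw
      exact ⟨⟨by linarith, by linarith⟩, (Complex.neg_pi_lt_log_im _).le, Complex.log_im_le_pi _⟩
    have h1 : axisRate r w₁ ^ δ / Real.cos (2 * β * w₁.re)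
        ≤ axisRate r w' ^ δ / Real.cos (2 * β * w'.re) := hmin₁ hw'Q
    rwa [hrate, hre, le_div_iff₀ (hcos w hw)] at h1

theorem IsDefiningFunction.exponent_lt (hμ : 0 < μ) (hη : IsWormProfile μ η)
    (hr : IsDefiningFunction r (worm η)) {δ : ℝ} (hδ : 0 < δ)
    (hu : StrictlyPlurisubharmonicOn (fun z => -(-r z) ^ δ) (worm η)) :
    δ < Real.pi / (2 * μ) := by
  by_contra! hle
  have hs : Real.pi / (2 * δ) ≤ μ := by
    rw [div_le_iff₀ (by positivity)] at hle ⊢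
    linarith
  obtain ⟨β, c, w₁, hβ0, hβδ, hc, hw₁, htouch, hbelow⟩ :=
    hr.exists_touching_cos hμ hη hδ hs
  set s := Real.pi / (2 * δ) with hsdef
  set T := expCos δ β with hT
  set F : ℂ → ℝ := fun w => (Real.exp (-2 * w.im) * axisRate r w) ^ δ with hF
  have hFeq : ∀ w : ℂ, |2 * w.re| ≤ s → F w = Real.exp (-2 * δ * w.im) * axisRate r w ^ δ := by
    intro w hw
    rw [hF]
    simp only
    rw [Real.mul_rpow (Real.exp_pos _).le (hr.axisRate_pos hμ hη (hw.trans hs)).le,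
      ← Real.exp_mul]
    ring_nf
  have hFT : ∀ w : ℂ, |2 * w.re| ≤ s → c * T w ≤ F w := by
    intro w hw
    rw [hFeq w hw, hT, expCos, mul_left_comm]
    exact mul_le_mul_of_nonneg_left (hbelow w hw).2 (Real.exp_pos _).le
  have hFT₁ : F w₁ = c * T w₁ := by
    rw [hFeq w₁ hw₁.le, hT, expCos, mul_left_comm, htouch]
  have hT₁ : 0 < T w₁ := mul_pos (Real.exp_pos _) (hbelow w₁ hw₁.le).1
  have hgap : 0 < δ ^ 2 - β ^ 2 := by nlinarith
  -- Half of the strict subharmonicity of `c T` at `w₁`: the penalty is still dominated wherever `T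
  -- > T w₁ / 2`.
  set κ := c * (δ ^ 2 - β ^ 2) * T w₁ / 2 with hκ
  have hκ0 : 0 < κ := by positivity
  obtain ⟨ρ, hρ, hball⟩ : ∃ ρ > 0, ∀ w ∈ Metric.closedBall w₁ ρ,
      |2 * w.re| < s ∧ T w₁ / 2 < T w := by
    have h1 : ∀ᶠ w in 𝓝 w₁, |2 * w.re| < s :=
      ((by fun_prop : Continuous fun w : ℂ => |2 * w.re|).tendsto w₁).eventually_lt_const hw₁
    have h2 : ∀ᶠ w in 𝓝 w₁, T w₁ / 2 < T w :=
      ((continuous_expCos δ β).tendsto w₁).eventually_const_lt (half_lt_self hT₁)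
    obtain ⟨ρ, hρ, h⟩ := Metric.nhds_basis_closedBall.eventually_iff.1 (h1.and h2)
    exact ⟨ρ, hρ, fun w hw => h hw⟩
  set ψ : ℝ → ℂ → ℝ := fun ε w => -(ε ^ δ)⁻¹ * (-(-r (wormCurve ε w)) ^ δ) - c * T w
    + κ * Complex.normSq (w - w₁) with hψ
  have hlim : ∀ w : ℂ, |2 * w.re| < s → Tendsto (fun p : ℂ × ℝ => ψ p.2 p.1) (𝓝 w ×ˢ 𝓝[>] 0)
      (𝓝 (F w - c * T w + κ * Complex.normSq (w - w₁))) := by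
    intro w hw
    have hfst : Tendsto (fun p : ℂ × ℝ => p.1) (𝓝 w ×ˢ 𝓝[>] 0) (𝓝 w) := tendsto_fst
    have h1 := (hr.tendsto_neg_div hη (hw.trans_le hs)).rpow_const (p := δ) (Or.inr hδ.le)
    have h2 := (((continuous_expCos δ β).tendsto w).comp hfst).const_mul c
    have h3 := ((((by fun_prop : Continuous fun w : ℂ => w - w₁).tendsto w).comp hfst))
    have h4 := ((Complex.continuous_normSq.tendsto _).comp h3).const_mul κ
    refine ((h1.sub h2).add h4).congr' ?_
    have hpos : ∀ᶠ p : ℂ × ℝ in 𝓝 w ×ˢ 𝓝[>] 0, 0 < p.2 :=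
      tendsto_snd.eventually self_mem_nhdsWithin
    filter_upwards [hpos, hη.eventually_wormCurve_mem (hw.trans_le hs)] with p hp hm
    simp only [hψ, Function.comp]
    rw [Real.div_rpow (neg_pos.2 (hr.neg hm)).le hp.le, neg_mul_neg, div_eq_inv_mul]
  have hmem : ∀ᶠ ε : ℝ in 𝓝[>] 0, ∀ w ∈ Metric.closedBall w₁ ρ, wormCurve ε w ∈ worm η :=
    (isCompact_closedBall w₁ ρ).eventually_forall_of_forall_eventually_prod fun w hw =>
      hη.eventually_wormCurve_mem ((hball w hw).1.trans_le hs)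
  -- In the limit `ψ` is at least `κ ρ ^ 2` on the sphere and `0` at the centre; the midpoint
  -- separates them for small `ε`, so `ψ ε` has an interior local minimum.
  have hsphere : ∀ᶠ ε : ℝ in 𝓝[>] 0, ∀ w ∈ Metric.sphere w₁ ρ, κ * ρ ^ 2 / 2 < ψ ε w := by
    refine (isCompact_sphere w₁ ρ).eventually_forall_of_forall_eventually_prod fun w hw => ?_
    have hws := (hball w (Metric.sphere_subset_closedBall hw)).1
    refine (hlim w hws).eventually_const_lt ?_
    have h1 : Complex.normSq (w - w₁) = ρ ^ 2 := by
      rw [Complex.normSq_eq_norm_sq, ← dist_eq_norm, Metric.mem_sphere.1 hw]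
    have h2 := hFT w hws.le
    have h3 : 0 < κ * ρ ^ 2 := by positivity
    rw [h1]
    linarith
  have hcenter : ∀ᶠ ε : ℝ in 𝓝[>] 0, ψ ε w₁ < κ * ρ ^ 2 / 2 := by
    have h1 := (hlim w₁ hw₁).comp
      ((tendsto_const_nhds (x := w₁)).prodMk (tendsto_id (x := 𝓝[>] (0 : ℝ))))
    refine h1.eventually_lt_const ?_
    rw [hFT₁, sub_self, sub_self, map_zero, mul_zero, add_zero]
    positivity
  obtain ⟨ε, hmem, hsphere, hcenter, hε⟩ :=
    (hmem.and (hsphere.and (hcenter.and self_mem_nhdsWithin))).exists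
  have hε : 0 < ε := hε
  have hC2 : ∀ w ∈ Metric.closedBall w₁ ρ,
      ContDiffAt ℝ 2 (fun z => -(-r z) ^ δ) (wormCurve ε w) := fun w hw =>
    hu.1.contDiffAt (hr.isOpen.mem_nhds (hmem w hw))
  have hψc : ContinuousOn (ψ ε) (Metric.closedBall w₁ ρ) := by
    intro w hw
    have hcurve : ContinuousAt (wormCurve ε) w := by unfold wormCurve; fun_prop
    have h1 : ContinuousAt (fun w => -(-r (wormCurve ε w)) ^ δ) w :=
      ContinuousAt.comp (g := fun z => -(-r z) ^ δ) (hC2 w hw).continuousAt hcurve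
    have h2 : ContinuousAt T w := (continuous_expCos δ β).continuousAt
    have h3 : ContinuousAt (fun w => Complex.normSq (w - w₁)) w :=
      (Complex.continuous_normSq.comp (continuous_id.sub continuous_const)).continuousAt
    exact (((h1.const_mul _).sub (h2.const_mul c)).add (h3.const_mul κ)).continuousWithinAt
  obtain ⟨w, hw, hmin⟩ := Metric.exists_isLocalMin_mem_ball hψc
    (Metric.mem_closedBall_self hρ.le) fun z hz => hcenter.trans (hsphere z hz)
  have hw := Metric.ball_subset_closedBall hw
  have hlap := laplacian_nonneg_of_isLocalMin (hC2 w hw) hmin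
  have hV : wormCurveDeriv ε w ≠ 0 := fun h =>
    Complex.exp_ne_zero w (congrArg Prod.snd h)
  have hlevi := hu.2 _ (hmem w hw) _ hV
  -- At that minimum the Levi term is negative and `κ` is less than the loss from `c T`, so the
  -- Laplacian is negative.
  have hA : 0 < (ε ^ δ)⁻¹ := inv_pos.2 (Real.rpow_pos_of_pos hε δ)
  have h1 := mul_pos hA hlevi
  have h2 := mul_lt_mul_of_pos_left (hball w hw).2 (mul_pos hc hgap)
  rw [← hT] at hlap
  linarith

theorem mainTheorem2 :
    (∀ δ₀ : ℝ, 0 < δ₀ → ∃ μ₀ : ℝ, 0 < μ₀ ∧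
      ∀ μ : ℝ, μ₀ ≤ μ → ∀ η : ℝ → ℝ, IsWormProfile μ η →
        ∀ (r : ℂ × ℂ → ℝ) (δ : ℝ), IsDefiningFunction r (worm η) → 0 < δ →
          IsBoundedPshExhaustion (fun z => -(-r z) ^ δ) (worm η) → δ < δ₀) ∧
    (∀ μ : ℝ, 0 < μ → ∀ η : ℝ → ℝ, IsWormProfile μ η →
      ∀ (r : ℂ × ℂ → ℝ) (δ : ℝ), IsDefiningFunction r (worm η) → 0 < δ →
        IsBoundedPshExhaustion (fun z => -(-r z) ^ δ) (worm η) →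
          δ < Real.pi / (2 * μ)) := by
  -- The choice `μ₀ = π / (2 δ₀)` makes `π / (2 μ) ≤ δ₀` for all `μ ≥ μ₀`.
  refine ⟨fun δ₀ hδ₀ => ⟨Real.pi / (2 * δ₀), by positivity, ?_⟩,
    fun μ hμ η hη r δ hr hδ hu => hr.exponent_lt hμ hη hδ hu.strictlyPsh⟩
  intro μ hμ η hη r δ hr hδ hu
  have hμ0 : 0 < μ := lt_of_lt_of_le (by positivity) hμ
  refine (hr.exponent_lt hμ0 hη hδ hu.strictlyPsh).trans_le ?_
  rw [div_le_iff₀ (by positivity)] at hμ ⊢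
  linarith
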